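/- Let $C_0,C_1,C_2$ be circles of positive radius in the plane $\mathbb{R}^2=\mathbb{C}$ that are pairwise externally tangent. For circles $C,C'$ such that $C_0,C,C'$ are pairwise externally tangent, the three closed discs they bound divide the rest of the plane into two regions, exactly one of which is bounded; let $s(C,C')$, the successor, be the circle lying in the bounded region and tangent to all of $C_0,C,C'$. Let $\mathcal{C}$ be the smallest set of circles such that $C_1,C_2\in\mathcal{C}$ and $s(C,C')\in\mathcal{C}$ for all tangent $C,C'\in\mathcal{C}$; all circles of $\mathcal{C}$ are externally tangent to $C_0$. For $C\in\mathcal{C}$ with center $c$, put $v(C)=c-c_0$, where $c_0$ is the center of $C_0$, let $\ell^{1/2}(C)=\mathbb{R}\,v(C)^{1/2}$ be the real line spanned by a complex square root of $v(C)$, and let $\alpha(C)$ be the angle of $v(C)$ with the positive $x$-axis, where $\alpha(C_1)\in(-\pi,\pi]$ and $\alpha(C)-\alpha(C_1)\in(-\pi,\pi]$. Write $[\alpha(C_1),\alpha(C_2)]$ for the closed interval with end points $\alpha(C_1)$ and $\alpha(C_2)$, in whichever order; it contains $\alpha(C)$ for all $C\in\mathcal{C}$. An Apollonian curve associated to $(C_0,C_1,C_2)$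 is a continuous map $\gamma:[\alpha(C_1),\alpha(C_2)]\to\mathbb{R}^2$ such that \[\gamma(\alpha(C))-\gamma(\alpha(C'))\in\ell^{1/2}(s(C,C'))\qquad\text{for all tangent }C,C'\in\mathcal{C}.\] Theorem. For every ordered triple $(C_0,C_1,C_2)$ of pairwise externally tangent circles of positive radius there is a nonconstant Apollonian curve associated to it, and it is unique up to translation and scaling: if $\gamma,\gamma'$ are Apollonian curves associated to $(C_0,C_1,C_2)$ and $\gamma$ is not constant, then there are $a\in\mathbb{R}$ and $b\in\mathbb{R}^2$ with $\gamma'=a\gamma+b$. -/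

import Mathlib

open EuclideanGeometry

noncomputable section

namespace Apollonian

/-- A circle in the plane `ℝ² = ℂ`, given by its center and radius. Proper circles are those
with `0 < C.radius`. -/
abbrev PlaneCircle := Sphere ℂ

/-- The closed disc bounded by a circle. -/
def disc (C : PlaneCircle) : Set ℂ := Metric.closedBall C.center C.radius

/-- `S` is the successor of the externally tangent triple `(C₀, C, C')`: the circle that is
tangent to all three circles (necessarily externally) and lies in the bounded one of the regions
into which the three closed discs divide the plane. The open disc bounded by `S` is
connected and misses the three closed discs, so it lies in the connected component of its
center. -/
structure IsSuccessor (C₀ C C' S : PlaneCircle) : Prop where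
  radius_pos : 0 < S.radius
  tangent₀ : C₀.IsExtTangent S
  tangent₁ : C.IsExtTangent S
  tangent₂ : C'.IsExtTangent S
  bounded_region :
    Bornology.IsBounded (connectedComponentIn (disc C₀ ∪ disc C ∪ disc C')ᶜ S.center)

/-- The smallest family of circles containing `C₁` and `C₂` and containing, with any two tangent
circles `C`, `C'`, the successor of `(C₀, C, C')`. -/
inductive Family (C₀ C₁ C₂ : PlaneCircle) : PlaneCircle → Prop
  | left : Family C₀ C₁ C₂ C₁
  | right : Family C₀ C₁ C₂ C₂
  | succ {C C' S : PlaneCircle} : Family C₀ C₁ C₂ C → Family C₀ C₁ C₂ C' →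
      C.IsExtTangent C' → IsSuccessor C₀ C C' S → Family C₀ C₁ C₂ S

/-- The vector `v(C) = c - c₀` from the center of `C₀` to the center of `C`. -/
def v (C₀ C : PlaneCircle) : ℂ := C.center - C₀.center

/-- The angle `α(C)` of the vector `v(C)` with the positive `x`-axis. Angles are only defined
modulo `2π`; the values are chosen so that `α(C₁)` is the principal argument of `v(C₁)` and every
other angle is at signed distance in `(-π, π]` from it. -/
def angle (C₀ C₁ C : PlaneCircle) : ℝ :=
  Complex.arg (v C₀ C₁) + Complex.arg (v C₀ C / v C₀ C₁)

/-- The closed interval with end points `α(C₁)` and `α(C₂)`, in whichever order these lie on the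
real line. -/
def angleInterval (C₀ C₁ C₂ : PlaneCircle) : Set ℝ :=
  Set.uIcc (angle C₀ C₁ C₁) (angle C₀ C₁ C₂)

/-- The real line `ℝ v(C)^{1/2}` spanned by a complex square root of `v(C)`; the two square roots
span the same line. -/
def sqrtLine (C₀ C : PlaneCircle) : Set ℂ :=
  {z | ∃ w : ℂ, w ^ 2 = v C₀ C ∧ ∃ t : ℝ, z = t * w}

/-- `γ`, regarded as a function on the interval `[α(C₁), α(C₂)]`, is an Apollonian curve associated
to the triple `(C₀, C₁, C₂)`: it is continuous there, and for all tangent circles `C`, `C'` of the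
family the angles lie in the interval and `γ(α(C)) - γ(α(C'))` is on the square-root line of
the successor of `(C₀, C, C')`. -/
structure IsApollonianCurve (C₀ C₁ C₂ : PlaneCircle) (γ : ℝ → ℂ) : Prop where
  continuousOn : ContinuousOn γ (angleInterval C₀ C₁ C₂)
  chord : ∀ C C' : PlaneCircle, Family C₀ C₁ C₂ C → Family C₀ C₁ C₂ C' → C.IsExtTangent C' →
    angle C₀ C₁ C ∈ angleInterval C₀ C₁ C₂ ∧ angle C₀ C₁ C' ∈ angleInterval C₀ C₁ C₂ ∧
    ∃ S : PlaneCircle, IsSuccessor C₀ C C' S ∧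
      γ (angle C₀ C₁ C) - γ (angle C₀ C₁ C') ∈ sqrtLine C₀ S

/-- `γ` is not constant on the interval `[α(C₁), α(C₂)]`. -/
def Nonconstant (C₀ C₁ C₂ : PlaneCircle) (γ : ℝ → ℂ) : Prop :=
  ∃ s ∈ angleInterval C₀ C₁ C₂, ∃ t ∈ angleInterval C₀ C₁ C₂, γ s ≠ γ t

end Apollonian

end

/-!
A circle `C` tangent to `C₀` is encoded by a spinor, a square root `ψ` of `v(C) / r(C)`. Two such
circles are tangent iff their spinors span area `±1`, and if `ψ`, `φ` are spinors of tangent circles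
with signs chosen so that they form an acute angle, then the successor has spinor `ψ + φ`; the other
circle tangent to all three, with spinor `ψ - φ`, is separated from their centers by a line. So the
circles of the family have spinors `p ψ + q φ` with `p`, `q ≥ 0` coprime, tangency means
`p q' - p' q = ±1`, and `ℓ^{1/2}` of the successor is the line spanned by the sum of the spinors.

Parametrizing by `q / (p + q)` turns Apollonian curves into curves on the unit interval whose chord
between Farey neighbours is parallel to the sum of the corresponding vectors. One nonzero chord
determines all the others by Farey subdivision, so by density such a curve is unique up to scaling
and translation. An example is a de Rham curve, both halves of which are images of the whole curve
under shears scaled by `1 / 3`.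
-/

namespace Apollonian

open scoped InnerProductSpace unitInterval

attribute [local instance] Complex.finrank_real_complex_fact

local notation "ω" => Complex.orientation.areaForm

section Regions

theorem frontier_simplex_subset {ι E : Type*} [Finite ι] [NormedAddCommGroup E] [NormedSpace ℝ E]
    (b : AffineBasis ι ℝ E) :
    frontier (convexHull ℝ (Set.range b)) ⊆ ⋃ i, convexHull ℝ (b '' {i}ᶜ) := by
  classical
  have := Fintype.ofFinite ι
  have hclosed : IsClosed (convexHull ℝ (Set.range b)) :=
    (Set.finite_range b).isClosed_convexHull ℝ
  intro x hx
  rw [hclosed.frontier_eq, b.interior_convexHull, b.convexHull_eq_nonneg_coord] at hx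
  obtain ⟨hnonneg, hnotpos⟩ := hx
  simp only [Set.mem_ofPred_eq, not_forall, not_lt] at hnonneg hnotpos
  obtain ⟨i, hi⟩ := hnotpos
  have hzero : b.coord i x = 0 := le_antisymm hi (hnonneg i)
  have hsum : ∑ j ∈ Finset.univ.erase i, b.coord j x = 1 :=
    (Finset.sum_erase (f := fun j ↦ b.coord j x) _ hzero).trans (b.sum_coord_apply_eq_one x)
  have hcomb : ∑ j ∈ Finset.univ.erase i, b.coord j x • b j = x := by
    rw [Finset.sum_erase _ (by rw [hzero, zero_smul]), b.linear_combination_coord_eq_self]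
  rw [Set.mem_iUnion]
  refine ⟨i, hcomb ▸ (convex_convexHull ℝ _).sum_mem (fun j _ ↦ hnonneg j) hsum fun j hj ↦ ?_⟩
  exact subset_convexHull ℝ _ ⟨j, Finset.ne_of_mem_erase hj, rfl⟩

theorem connectedComponentIn_compl_subset_of_frontier_subset {X : Type*} [TopologicalSpace X]
    {K T : Set X} {s : X} (hT : frontier T ⊆ K) (hsT : s ∈ T) (hsK : s ∉ K) :
    connectedComponentIn Kᶜ s ⊆ T := by
  have hmem : ∀ x ∈ closure T, x ∉ K → x ∈ interior T := fun x hx hxK ↦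
    by_contra fun hxT ↦ hxK (hT ⟨hx, hxT⟩)
  refine (isPreconnected_connectedComponentIn.subset_of_closure_inter_subset isOpen_interior
    ⟨s, mem_connectedComponentIn hsK, hmem s (subset_closure hsT) hsK⟩ ?_).trans interior_subset
  exact fun x hx ↦ hmem x (closure_mono interior_subset hx.1) (connectedComponentIn_subset _ _ hx.2)

theorem not_isBounded_connectedComponentIn_of_ray {E : Type*} [NormedAddCommGroup E]
    [NormedSpace ℝ E] {U : Set E} {s n : E} (hn : n ≠ 0)
    (hray : ∀ t : ℝ, 0 ≤ t → s + t • n ∈ U) :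
    ¬ Bornology.IsBounded (connectedComponentIn U s) := by
  intro hb
  let f : ℝ → E := fun t ↦ s + t • n
  have hf : Continuous f := by fun_prop
  have hsub : f '' Set.Ici 0 ⊆ connectedComponentIn U s :=
    (isPreconnected_Ici.image f hf.continuousOn).subset_connectedComponentIn
      ⟨0, Set.self_mem_Ici, by simp [f]⟩ (Set.image_subset_iff.2 hray)
  obtain ⟨M, hM⟩ := (hb.subset hsub).subset_closedBall s
  have ht : 0 ≤ (|M| + 1) / ‖n‖ := by positivity
  have hdist : dist (f ((|M| + 1) / ‖n‖)) s = |M| + 1 := by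
    rw [dist_eq_norm, add_sub_cancel_left, norm_smul, Real.norm_of_nonneg ht,
      div_mul_cancel₀ _ (norm_ne_zero_iff.2 hn)]
  have := (hdist ▸ Metric.mem_closedBall.1 (hM ⟨_, ht, rfl⟩)).trans (le_abs_self M)
  linarith

theorem dist_le_dist_add_smul {E : Type*} [NormedAddCommGroup E] [InnerProductSpace ℝ E]
    {c s n : E} (h : ⟪n, c - s⟫_ℝ ≤ 0) {t : ℝ} (ht : 0 ≤ t) :
    dist s c ≤ dist (s + t • n) c := by
  have hexp : ‖s + t • n - c‖ ^ 2 = ‖s - c‖ ^ 2 - 2 * (t * ⟪n, c - s⟫_ℝ) + ‖t • n‖ ^ 2 := by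
    rw [show s + t • n - c = (s - c) + t • n by abel, norm_add_sq_real, real_inner_comm,
      inner_smul_left, ← neg_sub c s, inner_neg_right, RCLike.conj_to_real]
    ring
  rw [dist_eq_norm, dist_eq_norm, ← sq_le_sq₀ (norm_nonneg _) (norm_nonneg _), hexp]
  linarith [mul_nonpos_of_nonneg_of_nonpos ht h, sq_nonneg ‖t • n‖]

theorem segment_subset_disc_union {C C' : PlaneCircle} (h : C.IsExtTangent C') :
    segment ℝ C.center C'.center ⊆ disc C ∪ disc C' := by
  intro z hz
  have hdist := (dist_add_dist_of_mem_segment hz).trans h.dist_center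
  rw [dist_comm] at hdist
  simp only [disc, Set.mem_union, Metric.mem_closedBall]
  by_contra! hfar
  linarith

theorem center_notMem_disc_union {C₀ C C' S : PlaneCircle} (hS : 0 < S.radius)
    (h₀ : C₀.IsExtTangent S) (h : C.IsExtTangent S) (h' : C'.IsExtTangent S) :
    S.center ∉ disc C₀ ∪ disc C ∪ disc C' := by
  simp only [disc, Set.mem_union, Metric.mem_closedBall, dist_comm S.center, h₀.dist_center,
    h.dist_center, h'.dist_center, add_le_iff_nonpos_right, or_self, not_le, hS]

theorem not_isBounded_connectedComponentIn_of_separated {C₀ C C' : PlaneCircle} {s n : ℂ}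
    (hn : n ≠ 0) (hs : s ∉ disc C₀ ∪ disc C ∪ disc C') (h₀ : ⟪n, C₀.center - s⟫_ℝ ≤ 0)
    (h : ⟪n, C.center - s⟫_ℝ ≤ 0) (h' : ⟪n, C'.center - s⟫_ℝ ≤ 0) :
    ¬ Bornology.IsBounded (connectedComponentIn (disc C₀ ∪ disc C ∪ disc C')ᶜ s) := by
  refine not_isBounded_connectedComponentIn_of_ray hn fun t ht ↦ ?_
  simp only [disc, Set.mem_compl_iff, Set.mem_union, Metric.mem_closedBall, not_or, not_le]
    at hs ⊢
  exact ⟨⟨hs.1.1.trans_le (dist_le_dist_add_smul h₀ ht),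
    hs.1.2.trans_le (dist_le_dist_add_smul h ht)⟩, hs.2.trans_le (dist_le_dist_add_smul h' ht)⟩

theorem affineIndependent_centers {C₀ C C' : PlaneCircle} (hr₀ : 0 < C₀.radius)
    (hr : 0 < C.radius) (hr' : 0 < C'.radius) (h : C₀.IsExtTangent C) (h' : C₀.IsExtTangent C')
    (hCC' : C.IsExtTangent C') :
    AffineIndependent ℝ ![C₀.center, C.center, C'.center] := by
  rw [affineIndependent_iff_not_collinear_set]
  intro hcol
  rcases hcol.wbtw_or_wbtw_or_wbtw with hw | hw | hw <;>
  linarith [hw.dist_add_dist, h.dist_center, h'.dist_center, hCC'.dist_center,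
    dist_comm C.center C₀.center, dist_comm C'.center C₀.center, dist_comm C'.center C.center]

theorem isBounded_connectedComponentIn_of_mem_triangle {C₀ C C' : PlaneCircle}
    (hr₀ : 0 < C₀.radius) (hr : 0 < C.radius) (hr' : 0 < C'.radius)
    (h : C₀.IsExtTangent C) (h' : C₀.IsExtTangent C') (hCC' : C.IsExtTangent C') {s : ℂ}
    (hs : s ∉ disc C₀ ∪ disc C ∪ disc C')
    (hsT : s ∈ convexHull ℝ {C₀.center, C.center, C'.center}) :
    Bornology.IsBounded (connectedComponentIn (disc C₀ ∪ disc C ∪ disc C')ᶜ s) := by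
  have hind := affineIndependent_centers hr₀ hr hr' h h' hCC'
  let b : AffineBasis (Fin 3) ℝ ℂ := ⟨_, hind,
    hind.affineSpan_eq_top_iff_card_eq_finrank_add_one.2 (by simp)⟩
  have hrange : Set.range b = {C₀.center, C.center, C'.center} := by
    change Set.range ![C₀.center, C.center, C'.center] = _
    grind [Matrix.range_cons, Matrix.range_empty]
  have hfrontier : frontier (convexHull ℝ (Set.range b)) ⊆ disc C₀ ∪ disc C ∪ disc C' := by
    refine (frontier_simplex_subset b).trans (Set.iUnion_subset fun i ↦ ?_)
    have hside : ∀ j k, ({i}ᶜ : Set (Fin 3)) = {j, k} →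
        convexHull ℝ (b '' {i}ᶜ) = segment ℝ (b j) (b k) := fun j k hjk ↦ by
      rw [hjk, Set.image_pair, convexHull_pair]
    fin_cases i
    · rw [hside 1 2 (by ext j; fin_cases j <;> simp)]
      exact (segment_subset_disc_union hCC').trans (by grind)
    · rw [hside 0 2 (by ext j; fin_cases j <;> simp)]
      exact (segment_subset_disc_union h').trans (by grind)
    · rw [hside 0 1 (by ext j; fin_cases j <;> simp)]
      exact (segment_subset_disc_union h).trans (by grind)
  exact ((isBounded_convexHull.2 (Set.finite_range b).isBounded).subset
    (connectedComponentIn_compl_subset_of_frontier_subset hfrontier (hrange ▸ hsT) hs))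

end Regions

section Spinors

variable {C₀ : PlaneCircle} {ψ φ χ : ℂ}

theorem areaForm_mul_mul (z x y : ℂ) : ω (z * x) (z * y) = ‖z‖ ^ 2 * ω x y := by
  simp only [Complex.areaForm, ← Complex.normSq_eq_norm_sq, Complex.normSq_apply, map_mul,
    Complex.mul_im, Complex.mul_re, Complex.conj_re, Complex.conj_im]
  ring

theorem areaForm_sq_sq (x y : ℂ) : ω (x ^ 2) (y ^ 2) = 2 * ⟪x, y⟫_ℝ * ω x y := by
  simp only [Complex.areaForm, Complex.inner, pow_two, map_mul, Complex.mul_im, Complex.mul_re,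
    Complex.conj_re, Complex.conj_im]
  ring

theorem inner_sq_sq (x y : ℂ) : ⟪x ^ 2, y ^ 2⟫_ℝ = ⟪x, y⟫_ℝ ^ 2 - ω x y ^ 2 := by
  simp only [Complex.areaForm, Complex.inner, pow_two, map_mul, Complex.mul_im, Complex.mul_re,
    Complex.conj_re, Complex.conj_im]
  ring

theorem inner_smul_add_sq (x y : ℂ) :
    ⟪x, y⟫_ℝ • (x + y) ^ 2 =
      (⟪x, y⟫_ℝ + ‖y‖ ^ 2) • x ^ 2 + (⟪x, y⟫_ℝ + ‖x‖ ^ 2) • y ^ 2 := by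
  simp only [Complex.inner, ← Complex.normSq_eq_norm_sq, Complex.normSq_apply]
  simp only [pow_two]
  apply Complex.ext <;>
  · simp only [Complex.real_smul, Complex.mul_re, Complex.mul_im, Complex.conj_re,
      Complex.conj_im, Complex.add_re, Complex.add_im, Complex.ofReal_re, Complex.ofReal_im]
    ring

theorem areaForm_smul_eq (x y z : ℂ) : ω x y • z = ω z y • x + ω x z • y := by
  simp only [Complex.areaForm]
  apply Complex.ext <;>
  · simp only [Complex.real_smul, Complex.mul_re, Complex.mul_im, Complex.conj_re,
      Complex.conj_im, Complex.add_re, Complex.add_im, Complex.ofReal_re, Complex.ofReal_im]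
    ring

/-- The circle externally tangent to `C₀` whose spinor is `ψ`: a spinor of a circle `C` is a square
root of `v(C)` divided by the radius of `C`. It is determined up to sign, and `‖ψ‖ > 1` because
`‖v(C)‖` is the sum of the radii. -/
noncomputable def spinorCircle (C₀ : PlaneCircle) (ψ : ℂ) : PlaneCircle where
  center := C₀.center + (C₀.radius / (‖ψ‖ ^ 2 - 1)) • ψ ^ 2
  radius := C₀.radius / (‖ψ‖ ^ 2 - 1)

theorem spinorCircle_congr (h : ψ ^ 2 = φ ^ 2) : spinorCircle C₀ ψ = spinorCircle C₀ φ := by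
  simp only [spinorCircle, ← norm_pow, h]

theorem v_spinorCircle (C₀ : PlaneCircle) (ψ : ℂ) :
    v C₀ (spinorCircle C₀ ψ) = (spinorCircle C₀ ψ).radius • ψ ^ 2 :=
  add_sub_cancel_left _ _

theorem sub_one_pos_of_one_lt_norm (hψ : 1 < ‖ψ‖) : 0 < ‖ψ‖ ^ 2 - 1 :=
  sub_pos.2 (one_lt_pow₀ hψ two_ne_zero)

theorem spinorCircle_radius_pos (h₀ : 0 < C₀.radius) (hψ : 1 < ‖ψ‖) :
    0 < (spinorCircle C₀ ψ).radius :=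
  div_pos h₀ (sub_one_pos_of_one_lt_norm hψ)

theorem spinorCircle_radius_mul_norm_sq (hψ : 1 < ‖ψ‖) :
    (spinorCircle C₀ ψ).radius * ‖ψ‖ ^ 2 = C₀.radius + (spinorCircle C₀ ψ).radius := by
  have := (sub_one_pos_of_one_lt_norm hψ).ne'
  simp only [spinorCircle]
  field_simp
  ring

theorem isExtTangent_iff_dist_eq {C C' : PlaneCircle} (h : 0 ≤ C.radius) (h' : 0 ≤ C'.radius) :
    C.IsExtTangent C' ↔ dist C.center C'.center = C.radius + C'.radius := by
  rw [Sphere.isExtTangent_iff_dist_center]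
  exact ⟨And.left, fun hd ↦ ⟨hd, h, h'⟩⟩

theorem isExtTangent_spinorCircle (h₀ : 0 < C₀.radius) (hψ : 1 < ‖ψ‖) :
    C₀.IsExtTangent (spinorCircle C₀ ψ) := by
  have hr := spinorCircle_radius_pos h₀ hψ
  rw [isExtTangent_iff_dist_eq h₀.le hr.le, dist_comm, dist_eq_norm]
  change ‖v C₀ (spinorCircle C₀ ψ)‖ = _
  rw [v_spinorCircle, norm_smul, norm_pow, Real.norm_of_nonneg hr.le,
    spinorCircle_radius_mul_norm_sq hψ]

theorem exists_eq_spinorCircle {C : PlaneCircle} (h₀ : 0 < C₀.radius) (hr : 0 < C.radius)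
    (h : C₀.IsExtTangent C) : ∃ ψ, 1 < ‖ψ‖ ∧ C = spinorCircle C₀ ψ := by
  obtain ⟨ψ, hψ⟩ := IsAlgClosed.exists_pow_nat_eq (C.radius⁻¹ • v C₀ C) two_pos
  have hnorm : ‖ψ‖ ^ 2 - 1 = C₀.radius / C.radius := by
    rw [← norm_pow, hψ, norm_smul, norm_inv, Real.norm_of_nonneg hr.le, v, ← dist_eq_norm,
      dist_comm, h.dist_center]
    field_simp
    ring
  have hone : 1 < ‖ψ‖ := by
    have : 0 < ‖ψ‖ ^ 2 - 1 := hnorm ▸ div_pos h₀ hr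
    exact lt_of_pow_lt_pow_left₀ 2 (norm_nonneg ψ) (by linarith)
  have hradius : C₀.radius / (‖ψ‖ ^ 2 - 1) = C.radius := by
    rw [hnorm]
    field_simp
  refine ⟨ψ, hone, Sphere.ext ?_ hradius.symm⟩
  simp only [spinorCircle, hradius, hψ]
  rw [smul_inv_smul₀ hr.ne', v, add_sub_cancel]

theorem spinorCircle_isExtTangent_iff (h₀ : 0 < C₀.radius) (hψ : 1 < ‖ψ‖) (hφ : 1 < ‖φ‖) :
    (spinorCircle C₀ ψ).IsExtTangent (spinorCircle C₀ φ) ↔ ω ψ φ ^ 2 = 1 := by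
  have hr := spinorCircle_radius_pos h₀ hψ
  have hs := spinorCircle_radius_pos h₀ hφ
  have hrψ := spinorCircle_radius_mul_norm_sq (C₀ := C₀) hψ
  have hsφ := spinorCircle_radius_mul_norm_sq (C₀ := C₀) hφ
  have hcenter : (spinorCircle C₀ ψ).center - (spinorCircle C₀ φ).center =
      v C₀ (spinorCircle C₀ ψ) - v C₀ (spinorCircle C₀ φ) := (sub_sub_sub_cancel_right ..).symm
  rw [isExtTangent_iff_dist_eq hr.le hs.le, dist_eq_norm, hcenter, v_spinorCircle, v_spinorCircle,
    ← sq_eq_sq₀ (norm_nonneg _) (by positivity)]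
  set r := (spinorCircle C₀ ψ).radius
  set s := (spinorCircle C₀ φ).radius
  have hdist : ‖r • ψ ^ 2 - s • φ ^ 2‖ ^ 2 =
      (r * ‖ψ‖ ^ 2 - s * ‖φ‖ ^ 2) ^ 2 + 4 * (r * s) * ω ψ φ ^ 2 := by
    rw [norm_sub_sq_real, real_inner_smul_left, real_inner_smul_right, inner_sq_sq, norm_smul,
      norm_smul, norm_pow, norm_pow, Real.norm_of_nonneg hr.le, Real.norm_of_nonneg hs.le]
    linear_combination -2 * r * s * Complex.orientation.inner_sq_add_areaForm_sq ψ φ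
  have hrs : r * s ≠ 0 := by positivity
  rw [hdist, hrψ, hsφ, ← mul_right_inj' hrs (b := ω ψ φ ^ 2)]
  constructor <;> intro h <;> linarith

/-- Spinors of two tangent circles, both tangent to `C₀`, with the signs chosen so that the spinors
form an acute angle. -/
structure IsSpinorPair (ψ φ : ℂ) : Prop where
  one_lt_norm_left : 1 < ‖ψ‖
  one_lt_norm_right : 1 < ‖φ‖
  areaForm_sq : ω ψ φ ^ 2 = 1
  inner_pos : 0 < ⟪ψ, φ⟫_ℝ

namespace IsSpinorPair

theorem symm (h : IsSpinorPair ψ φ) : IsSpinorPair φ ψ where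
  one_lt_norm_left := h.one_lt_norm_right
  one_lt_norm_right := h.one_lt_norm_left
  areaForm_sq := by rw [Complex.orientation.areaForm_swap, neg_sq, h.areaForm_sq]
  inner_pos := by rw [real_inner_comm]; exact h.inner_pos

theorem one_lt_norm_add (h : IsSpinorPair ψ φ) : 1 < ‖ψ + φ‖ := by
  have := norm_add_sq_real ψ φ
  have := h.inner_pos
  refine h.one_lt_norm_left.trans (lt_of_pow_lt_pow_left₀ 2 (norm_nonneg _) ?_)
  linarith [sq_nonneg ‖φ‖]

theorem add_right (h : IsSpinorPair ψ φ) : IsSpinorPair ψ (ψ + φ) where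
  one_lt_norm_left := h.one_lt_norm_left
  one_lt_norm_right := h.one_lt_norm_add
  areaForm_sq := by
    rw [map_add, Complex.orientation.areaForm_apply_self, zero_add, h.areaForm_sq]
  inner_pos := by
    rw [inner_add_right]
    exact add_pos_of_nonneg_of_pos real_inner_self_nonneg h.inner_pos

theorem add_left (h : IsSpinorPair ψ φ) : IsSpinorPair (ψ + φ) φ := by
  rw [add_comm]
  exact h.symm.add_right.symm

theorem isExtTangent (h₀ : 0 < C₀.radius) (h : IsSpinorPair ψ φ) :
    (spinorCircle C₀ ψ).IsExtTangent (spinorCircle C₀ φ) :=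
  (spinorCircle_isExtTangent_iff h₀ h.one_lt_norm_left h.one_lt_norm_right).2 h.areaForm_sq

end IsSpinorPair

theorem exists_isSpinorPair {C₁ C₂ : PlaneCircle} (hr₀ : 0 < C₀.radius) (hr₁ : 0 < C₁.radius)
    (hr₂ : 0 < C₂.radius) (h₀₁ : C₀.IsExtTangent C₁) (h₀₂ : C₀.IsExtTangent C₂)
    (h₁₂ : C₁.IsExtTangent C₂) :
    ∃ ψ φ, IsSpinorPair ψ φ ∧ C₁ = spinorCircle C₀ ψ ∧ C₂ = spinorCircle C₀ φ := by
  obtain ⟨ψ, hψ, rfl⟩ := exists_eq_spinorCircle hr₀ hr₁ h₀₁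
  obtain ⟨φ, hφ, rfl⟩ := exists_eq_spinorCircle hr₀ hr₂ h₀₂
  rw [spinorCircle_isExtTangent_iff hr₀ hψ hφ] at h₁₂
  have hne : ⟪ψ, φ⟫_ℝ ≠ 0 := fun h ↦ by
    have hmul : (‖ψ‖ * ‖φ‖) ^ 2 = 1 := by
      rw [mul_pow, ← Complex.orientation.inner_sq_add_areaForm_sq, h, h₁₂]
      ring
    exact (one_lt_pow₀ (one_lt_mul_of_lt_of_le hψ hφ.le) two_ne_zero).ne' hmul
  rcases hne.lt_or_gt with hneg | hpos
  · exact ⟨ψ, -φ, ⟨hψ, by rwa [norm_neg], by rwa [map_neg, neg_sq],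
      by rwa [inner_neg_right, neg_pos]⟩, rfl, spinorCircle_congr (neg_sq φ).symm⟩
  · exact ⟨ψ, φ, ⟨hψ, hφ, h₁₂, hpos⟩, rfl, rfl⟩

theorem mem_sqrtLine_spinorCircle (h₀ : 0 < C₀.radius) (hψ : 1 < ‖ψ‖) {z : ℂ} :
    z ∈ sqrtLine C₀ (spinorCircle C₀ ψ) ↔ ∃ t : ℝ, z = t • ψ := by
  have hr := spinorCircle_radius_pos h₀ hψ
  set q : ℝ := √(spinorCircle C₀ ψ).radius
  have hq0 : q ≠ 0 := (Real.sqrt_pos.2 hr).ne'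
  have hroot : (q • ψ) ^ 2 = v C₀ (spinorCircle C₀ ψ) := by
    rw [smul_pow, Real.sq_sqrt hr.le, v_spinorCircle]
  constructor
  · rintro ⟨w, hw, t, rfl⟩
    rcases sq_eq_sq_iff_eq_or_eq_neg.1 (hw.trans hroot.symm) with rfl | rfl
    · exact ⟨t * q, by rw [mul_smul, Complex.real_smul (x := t)]⟩
    · exact ⟨-(t * q), by rw [neg_smul, mul_smul, Complex.real_smul (x := t), mul_neg]⟩
  · rintro ⟨t, rfl⟩
    exact ⟨q • ψ, hroot, t / q, by rw [← Complex.real_smul, smul_smul, div_mul_cancel₀ _ hq0]⟩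

end Spinors

section Successor

variable {C₀ S : PlaneCircle} {ψ φ χ : ℂ}

theorem add_smul_sub_add_smul_sub_mem_convexHull {E : Type*} [AddCommGroup E] [Module ℝ E]
    (x y z : E) {a b : ℝ} (ha : 0 ≤ a) (hb : 0 ≤ b) (hab : a + b ≤ 1) :
    x + (a • (y - x) + b • (z - x)) ∈ convexHull ℝ {x, y, z} := by
  have hcomb : x + (a • (y - x) + b • (z - x)) = ∑ i, ![1 - (a + b), a, b] i • ![x, y, z] i := by
    simp only [Fin.sum_univ_three, Matrix.cons_val]
    module
  rw [hcomb]
  refine (convex_convexHull ℝ _).sum_mem ?_ ?_ ?_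
  · simp [Fin.forall_fin_succ, ha, hb, hab]
  · simp only [Fin.sum_univ_three, Matrix.cons_val]
    ring
  · refine fun i _ ↦ subset_convexHull ℝ _ ?_
    fin_cases i <;> simp

theorem IsSpinorPair.center_mem_triangle (h₀ : 0 < C₀.radius) (h : IsSpinorPair ψ φ) :
    (spinorCircle C₀ (ψ + φ)).center ∈
      convexHull ℝ {C₀.center, (spinorCircle C₀ ψ).center, (spinorCircle C₀ φ).center} := by
  have hd := h.inner_pos
  have hA := sub_one_pos_of_one_lt_norm h.one_lt_norm_left
  have hB := sub_one_pos_of_one_lt_norm h.one_lt_norm_right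
  have hadd := norm_add_sq_real ψ φ
  have hnormS := sub_one_pos_of_one_lt_norm h.one_lt_norm_add
  have hprod := Complex.orientation.inner_sq_add_areaForm_sq ψ φ
  rw [h.areaForm_sq] at hprod
  have hcomb := inner_smul_add_sq ψ φ
  have hcenter : (spinorCircle C₀ (ψ + φ)).center =
      C₀.center + (((⟪ψ, φ⟫_ℝ + ‖φ‖ ^ 2) * (‖ψ‖ ^ 2 - 1) / (⟪ψ, φ⟫_ℝ * (‖ψ + φ‖ ^ 2 - 1))) •
          v C₀ (spinorCircle C₀ ψ) +
        ((⟪ψ, φ⟫_ℝ + ‖ψ‖ ^ 2) * (‖φ‖ ^ 2 - 1) / (⟪ψ, φ⟫_ℝ * (‖ψ + φ‖ ^ 2 - 1))) •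
          v C₀ (spinorCircle C₀ φ)) := by
    rw [← sub_eq_iff_eq_add']
    change v C₀ _ = _
    rw [v_spinorCircle, v_spinorCircle, v_spinorCircle,
      ← inv_smul_smul₀ hd.ne' ((ψ + φ) ^ 2), hcomb]
    simp only [spinorCircle]
    match_scalars <;> field_simp
  rw [hcenter]
  refine add_smul_sub_add_smul_sub_mem_convexHull _ _ _ (by positivity) (by positivity) ?_
  rw [← add_div, div_le_one (by positivity), hadd]
  linarith

theorem isSuccessor_spinorCircle_add (h₀ : 0 < C₀.radius) (h : IsSpinorPair ψ φ) :
    IsSuccessor C₀ (spinorCircle C₀ ψ) (spinorCircle C₀ φ) (spinorCircle C₀ (ψ + φ)) := by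
  have hψ := h.one_lt_norm_left
  have hφ := h.one_lt_norm_right
  have hr := spinorCircle_radius_pos h₀ h.one_lt_norm_add
  have t₀ := isExtTangent_spinorCircle h₀ h.one_lt_norm_add
  have t₁ := h.add_right.isExtTangent h₀
  have t₂ := (h.add_left.isExtTangent h₀).symm
  exact ⟨hr, t₀, t₁, t₂, isBounded_connectedComponentIn_of_mem_triangle h₀
    (spinorCircle_radius_pos h₀ hψ) (spinorCircle_radius_pos h₀ hφ)
    (isExtTangent_spinorCircle h₀ hψ) (isExtTangent_spinorCircle h₀ hφ) (h.isExtTangent h₀)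
    (center_notMem_disc_union hr t₀ t₁ t₂) (h.center_mem_triangle h₀)⟩

theorem IsSpinorPair.exists_separating (h : IsSpinorPair ψ φ) (hne : ψ ≠ φ) :
    ∃ n : ℂ, ⟪n, ψ ^ 2⟫_ℝ < 0 ∧ ⟪n, φ ^ 2⟫_ℝ < 0 ∧ 0 < ⟪n, (ψ - φ) ^ 2⟫_ℝ := by
  let n : ℂ := -(ω ψ φ • Complex.orientation.rightAngleRotation (ψ ^ 2 - φ ^ 2))
  have hn (z : ℂ) : ⟪n, z⟫_ℝ = ω ψ φ * (ω (φ ^ 2) z - ω (ψ ^ 2) z) := by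
    rw [inner_neg_left, real_inner_smul_left, Complex.orientation.inner_rightAngleRotation_left,
      map_sub, LinearMap.sub_apply]
    ring
  have hψ : ⟪n, ψ ^ 2⟫_ℝ = -(2 * ⟪ψ, φ⟫_ℝ) := by
    rw [hn, Complex.orientation.areaForm_apply_self, Complex.orientation.areaForm_swap (φ ^ 2),
      areaForm_sq_sq]
    linear_combination -2 * ⟪ψ, φ⟫_ℝ * h.areaForm_sq
  have hφ : ⟪n, φ ^ 2⟫_ℝ = -(2 * ⟪ψ, φ⟫_ℝ) := by
    rw [hn, Complex.orientation.areaForm_apply_self, areaForm_sq_sq]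
    linear_combination -2 * ⟪ψ, φ⟫_ℝ * h.areaForm_sq
  have hsub : ⟪n, (ψ - φ) ^ 2⟫_ℝ = 2 * ‖ψ - φ‖ ^ 2 := by
    have hω : ω (ψ + φ) (ψ - φ) = -2 * ω ψ φ := by
      simp only [map_add, map_sub, LinearMap.add_apply, Complex.orientation.areaForm_apply_self,
        Complex.orientation.areaForm_swap φ ψ]
      ring
    rw [hn, ← LinearMap.sub_apply, ← map_sub,
      show φ ^ 2 - ψ ^ 2 = (ψ - φ) * -(ψ + φ) by ring, pow_two, areaForm_mul_mul, map_neg,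
      LinearMap.neg_apply, hω]
    linear_combination 2 * ‖ψ - φ‖ ^ 2 * h.areaForm_sq
  have := h.inner_pos
  have := norm_pos_iff.2 (sub_ne_zero.2 hne)
  exact ⟨n, by linarith, by linarith, by rw [hsub]; positivity⟩

theorem not_isSuccessor_spinorCircle_sub (h₀ : 0 < C₀.radius) (h : IsSpinorPair ψ φ)
    (hχ : 1 < ‖ψ - φ‖) :
    ¬ IsSuccessor C₀ (spinorCircle C₀ ψ) (spinorCircle C₀ φ) (spinorCircle C₀ (ψ - φ)) := by
  set S := spinorCircle C₀ (ψ - φ) with hS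
  intro hsucc
  obtain ⟨n, hnψ, hnφ, hnS⟩ := h.exists_separating fun hψφ ↦ by
    rw [hψφ, sub_self, norm_zero] at hχ
    exact absurd hχ (not_lt.2 zero_le_one)
  have hn : n ≠ 0 := by
    rintro rfl
    rw [inner_zero_left] at hnψ
    exact lt_irrefl _ hnψ
  have hvS : 0 < ⟪n, v C₀ S⟫_ℝ := by
    rw [hS, v_spinorCircle, real_inner_smul_right]
    exact mul_pos hsucc.radius_pos hnS
  have hseparated (C : PlaneCircle) (hC : ⟪n, v C₀ C⟫_ℝ ≤ 0) :
      ⟪n, C.center - S.center⟫_ℝ ≤ 0 := by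
    rw [← sub_sub_sub_cancel_right _ _ C₀.center, inner_sub_right]
    exact sub_nonpos.2 (hC.trans hvS.le)
  have hvr {χ : ℂ} (hχ : 1 < ‖χ‖) (hnχ : ⟪n, χ ^ 2⟫_ℝ < 0) :
      ⟪n, v C₀ (spinorCircle C₀ χ)⟫_ℝ ≤ 0 := by
    rw [v_spinorCircle, real_inner_smul_right]
    exact (mul_neg_of_pos_of_neg (spinorCircle_radius_pos h₀ hχ) hnχ).le
  refine not_isBounded_connectedComponentIn_of_separated hn
    (center_notMem_disc_union hsucc.radius_pos hsucc.tangent₀ hsucc.tangent₁ hsucc.tangent₂)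
    (hseparated _ ?_) (hseparated _ (hvr h.one_lt_norm_left hnψ))
    (hseparated _ (hvr h.one_lt_norm_right hnφ)) hsucc.bounded_region
  rw [v, sub_self, inner_zero_right]

theorem sq_eq_add_sq_or_sub_sq (h : ω ψ φ ^ 2 = 1) (hψ : ω ψ χ ^ 2 = 1) (hφ : ω φ χ ^ 2 = 1) :
    χ ^ 2 = (ψ + φ) ^ 2 ∨ χ ^ 2 = (ψ - φ) ^ 2 := by
  have hsq : χ ^ 2 = ψ ^ 2 + φ ^ 2 + (2 * (ω χ φ * ω ψ χ : ℝ) : ℂ) * (ψ * φ) := by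
    have hcomb := congrArg (· ^ 2) (areaForm_smul_eq ψ φ χ)
    simp only [Complex.orientation.areaForm_swap χ φ, Complex.real_smul] at hcomb ⊢
    have e := congrArg Complex.ofReal h
    have e₁ := congrArg Complex.ofReal hψ
    have e₂ := congrArg Complex.ofReal hφ
    push_cast at e e₁ e₂ hcomb ⊢
    linear_combination hcomb - χ ^ 2 * e + ψ ^ 2 * e₂ + φ ^ 2 * e₁
  have hone : (ω χ φ * ω ψ χ) ^ 2 = 1 := by
    rw [mul_pow, hψ, Complex.orientation.areaForm_swap, neg_sq, hφ, one_mul]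
  rcases sq_eq_one_iff.1 hone with e | e <;> rw [e] at hsq <;> push_cast at hsq
  · exact .inl (by linear_combination hsq)
  · exact .inr (by linear_combination hsq)

theorem isSuccessor_iff (h₀ : 0 < C₀.radius) (h : IsSpinorPair ψ φ) :
    IsSuccessor C₀ (spinorCircle C₀ ψ) (spinorCircle C₀ φ) S ↔ S = spinorCircle C₀ (ψ + φ) := by
  refine ⟨fun hS ↦ ?_, fun hS ↦ hS ▸ isSuccessor_spinorCircle_add h₀ h⟩
  obtain ⟨χ, hχ, rfl⟩ := exists_eq_spinorCircle h₀ hS.radius_pos hS.tangent₀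
  have hψχ := (spinorCircle_isExtTangent_iff h₀ h.one_lt_norm_left hχ).1 hS.tangent₁
  have hφχ := (spinorCircle_isExtTangent_iff h₀ h.one_lt_norm_right hχ).1 hS.tangent₂
  rcases sq_eq_add_sq_or_sub_sq h.areaForm_sq hψχ hφχ with hadd | hsub
  · exact spinorCircle_congr hadd
  · have hnorm : 1 < ‖ψ - φ‖ := by
      rwa [← (pow_left_inj₀ (norm_nonneg χ) (norm_nonneg _) two_ne_zero).1
        (by rw [← norm_pow, ← norm_pow, hsub])]
    rw [spinorCircle_congr hsub] at hS
    exact absurd hS (not_isSuccessor_spinorCircle_sub h₀ h hnorm)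

end Successor

section Unimodular

/-- Two integer vectors with nonnegative entries span the lattice `ℤ²`. Read as the fractions
`a.2 / (a.1 + a.2)` and `b.2 / (b.1 + b.2)` they are Farey neighbours. -/
def Unimodular (a b : ℕ × ℕ) : Prop :=
  ((a.1 : ℤ) * b.2 - a.2 * b.1) ^ 2 = 1

namespace Unimodular

variable {a b : ℕ × ℕ}

theorem symm (h : Unimodular a b) : Unimodular b a := by
  rw [Unimodular, ← h]
  ring

theorem add_right (h : Unimodular a b) : Unimodular a (a + b) := by
  rw [Unimodular, ← h]
  push_cast [Prod.fst_add, Prod.snd_add]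
  ring

theorem add_left (h : Unimodular a b) : Unimodular (a + b) b := by
  rw [add_comm]
  exact h.symm.add_right.symm

theorem add_ne_zero_left (h : Unimodular a b) : a.1 + a.2 ≠ 0 := fun h0 ↦ by
  simp [Unimodular, Nat.add_eq_zero_iff.1 h0] at h

theorem of_add_right (h : Unimodular a (a + b)) : Unimodular a b := by
  rw [Unimodular, ← h]
  push_cast [Prod.fst_add, Prod.snd_add]
  ring

theorem of_add_left (h : Unimodular (a + b) b) : Unimodular a b := by
  rw [add_comm] at h
  exact h.symm.of_add_right.symm

theorem transpose (h : Unimodular a b) : Unimodular (a.1, b.1) (a.2, b.2) := by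
  rw [Unimodular, ← h]
  ring

theorem shear_left (h : Unimodular a b) : Unimodular (a.1 + a.2, a.2) (b.1 + b.2, b.2) :=
  h.transpose.add_left.transpose

theorem shear_right (h : Unimodular a b) : Unimodular (a.1, a.1 + a.2) (b.1, b.1 + b.2) :=
  h.transpose.add_right.transpose

theorem le_or_le_or_eq (h : Unimodular a b) :
    a ≤ b ∨ b ≤ a ∨ (a = (1, 0) ∧ b = (0, 1)) ∨ (a = (0, 1) ∧ b = (1, 0)) := by
  obtain ⟨p, q⟩ := a
  obtain ⟨p', q'⟩ := b
  simp only [Unimodular, sq_eq_one_iff] at h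
  simp only [Prod.mk_le_mk, Prod.mk.injEq]
  have hdet : p * q' = q * p' + 1 ∨ q * p' = p * q' + 1 := by zify; omega
  rcases le_or_gt p p' with hp | hp <;> rcases le_or_gt q q' with hq | hq
  · exact .inl ⟨hp, hq⟩
  · rcases hp.eq_or_lt with rfl | hp
    · exact .inr (.inl ⟨le_rfl, hq.le⟩)
    · have hlt : (q' + 1) * (p + 1) ≤ q * p' := Nat.mul_le_mul hq hp
      have : p = 0 ∧ q' = 0 := by
        rcases hdet with hdet | hdet <;> constructor <;> nlinarith
      obtain ⟨rfl, rfl⟩ := this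
      have : q * p' = 1 := by omega
      exact .inr (.inr (.inr ⟨⟨rfl, (mul_eq_one.1 this).1⟩, (mul_eq_one.1 this).2, rfl⟩))
  · rcases hq.eq_or_lt with rfl | hq
    · exact .inr (.inl ⟨hp.le, le_rfl⟩)
    · have hlt : (p' + 1) * (q + 1) ≤ p * q' := Nat.mul_le_mul hp hq
      have : p' = 0 ∧ q = 0 := by
        rcases hdet with hdet | hdet <;> constructor <;> nlinarith
      obtain ⟨rfl, rfl⟩ := this
      have : p * q' = 1 := by omega
      exact .inr (.inr (.inl ⟨⟨(mul_eq_one.1 this).1, rfl⟩, rfl, (mul_eq_one.1 this).2⟩))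
  · exact .inr (.inl ⟨hp.le, hq.le⟩)

theorem one_zero : Unimodular (1, 0) (0, 1) := by
  simp [Unimodular]

-- Subtractive Euclidean algorithm: a unimodular pair other than the two bases is comparable, and
-- subtracting its smaller vector from the larger one keeps it unimodular.
@[elab_as_elim]
theorem induction {P : (a b : ℕ × ℕ) → Unimodular a b → Prop} (base : P (1, 0) (0, 1) one_zero)
    (base' : P (0, 1) (1, 0) one_zero.symm)
    (right : ∀ a b h, P a b h → P a (a + b) h.add_right)
    (left : ∀ a b h, P a b h → P (a + b) b h.add_left) (h : Unimodular a b) : P a b h := by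
  induction hn : a.1 + a.2 + (b.1 + b.2) using Nat.strong_induction_on generalizing a b with
  | h n ih =>
    rcases h.le_or_le_or_eq with hab | hba | ⟨rfl, rfl⟩ | ⟨rfl, rfl⟩
    · obtain ⟨c, rfl⟩ := le_iff_exists_add.1 hab
      refine right a c h.of_add_right (ih _ ?_ h.of_add_right rfl)
      simp only [Prod.fst_add, Prod.snd_add] at hn
      have := h.add_ne_zero_left
      omega
    · obtain ⟨c, rfl⟩ := le_iff_exists_add'.1 hba
      refine left c b h.of_add_left (ih _ ?_ h.of_add_left rfl)
      simp only [Prod.fst_add, Prod.snd_add] at hn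
      have := h.symm.add_ne_zero_left
      omega
    · exact base
    · exact base'

@[elab_as_elim]
theorem shear_induction {P : (a b : ℕ × ℕ) → Unimodular a b → Prop}
    (base : P (1, 0) (0, 1) one_zero) (base' : P (0, 1) (1, 0) one_zero.symm)
    (left : ∀ a b h, P a b h → P (a.1 + a.2, a.2) (b.1 + b.2, b.2) h.shear_left)
    (right : ∀ a b h, P a b h → P (a.1, a.1 + a.2) (b.1, b.1 + b.2) h.shear_right)
    (h : Unimodular a b) : P a b h :=
  h.transpose.induction (P := fun c d hcd ↦ P (c.1, d.1) (c.2, d.2) hcd.transpose) base base'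
    (fun _ _ h ↦ right _ _ h.transpose) (fun _ _ h ↦ left _ _ h.transpose)

end Unimodular

theorem exists_unimodular_of_coprime {p q : ℕ} (h : p.Coprime q) : ∃ b, Unimodular (p, q) b := by
  rcases lt_trichotomy q 1 with hq | rfl | hq
  · obtain rfl : q = 0 := by omega
    obtain rfl : p = 1 := by simpa using h
    exact ⟨(0, 1), .one_zero⟩
  · exact ⟨(1, 0), by simp [Unimodular]⟩
  · obtain ⟨m, -, hm⟩ := Nat.exists_mul_mod_eq_one_of_coprime h hq
    refine ⟨(p * m / q, m), ?_⟩
    have hdiv : (q : ℤ) * (p * m / q : ℕ) + 1 = p * m := by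
      exact_mod_cast hm ▸ Nat.div_add_mod (p * m) q
    rw [Unimodular, ← hdiv]
    ring

/-- The combination `a.1 • u + a.2 • w` of `u` and `w` with natural coefficients, as an additive
function of the coefficients. -/
def natCombo {E : Type*} [AddCommMonoid E] (u w : E) : ℕ × ℕ →+ E :=
  (multiplesHom E u).coprod (multiplesHom E w)

theorem natCombo_apply {E : Type*} [AddCommMonoid E] (u w : E) (a : ℕ × ℕ) :
    natCombo u w a = a.1 • u + a.2 • w := rfl

theorem natCombo_one_zero {E : Type*} [AddCommMonoid E] (u w : E) :
    natCombo u w (1, 0) = u := by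
  simp [natCombo_apply]

theorem natCombo_zero_one {E : Type*} [AddCommMonoid E] (u w : E) :
    natCombo u w (0, 1) = w := by
  simp [natCombo_apply]

theorem eq_zero_of_smul_natCombo_eq {E : Type*} [AddCommGroup E] [Module ℝ E]
    {u w : E} (huw : LinearIndependent ℝ ![u, w]) {a b : ℕ × ℕ} (hab : a.1 * b.2 ≠ a.2 * b.1)
    {s t : ℝ} (h : s • natCombo u w a = t • natCombo u w b) : s = 0 := by
  obtain ⟨hu, hw⟩ := LinearIndependent.pair_iff.1 huw (s * a.1 - t * b.1) (s * a.2 - t * b.2) <| by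
    simp only [natCombo_apply, ← Nat.cast_smul_eq_nsmul ℝ] at h
    linear_combination (norm := module) h
  have hdet : s * ((a.1 * b.2 : ℕ) - (a.2 * b.1 : ℕ)) = 0 := by
    push_cast
    linear_combination (b.2 : ℝ) * hu - (b.1 : ℝ) * hw
  exact (mul_eq_zero.1 hdet).resolve_right (sub_ne_zero.2 (by exact_mod_cast hab))

end Unimodular

section Family

variable {C₀ C : PlaneCircle} {ψ φ : ℂ} {a b : ℕ × ℕ}

theorem isSpinorPair_natCombo (h : IsSpinorPair ψ φ) (hab : Unimodular a b) :
    IsSpinorPair (natCombo ψ φ a) (natCombo ψ φ b) := by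
  induction hab using Unimodular.induction with
  | base => simpa only [natCombo_one_zero, natCombo_zero_one] using h
  | base' => simpa only [natCombo_one_zero, natCombo_zero_one] using h.symm
  | right a b _ ih => rw [map_add]; exact ih.add_right
  | left a b _ ih => rw [map_add]; exact ih.add_left

theorem areaForm_natCombo (ψ φ : ℂ) (a b : ℕ × ℕ) :
    ω (natCombo ψ φ a) (natCombo ψ φ b) = (a.1 * b.2 - a.2 * b.1 : ℤ) * ω ψ φ := by
  simp only [natCombo_apply, ← Nat.cast_smul_eq_nsmul ℝ, map_add, map_smul, LinearMap.add_apply,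
    LinearMap.smul_apply, smul_eq_mul, Complex.orientation.areaForm_apply_self,
    Complex.orientation.areaForm_swap φ ψ]
  push_cast
  ring

theorem IsSpinorPair.isExtTangent_natCombo_iff {a' b' : ℕ × ℕ} (h₀ : 0 < C₀.radius)
    (h : IsSpinorPair ψ φ) (ha : Unimodular a a') (hb : Unimodular b b') :
    (spinorCircle C₀ (natCombo ψ φ a)).IsExtTangent (spinorCircle C₀ (natCombo ψ φ b)) ↔
      Unimodular a b := by
  rw [spinorCircle_isExtTangent_iff h₀ (isSpinorPair_natCombo h ha).one_lt_norm_left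
    (isSpinorPair_natCombo h hb).one_lt_norm_left, areaForm_natCombo, mul_pow, h.areaForm_sq,
    mul_one, Unimodular]
  norm_cast

theorem family_spinorCircle_iff (h₀ : 0 < C₀.radius) (h : IsSpinorPair ψ φ) :
    Family C₀ (spinorCircle C₀ ψ) (spinorCircle C₀ φ) C ↔
      ∃ a b, Unimodular a b ∧ C = spinorCircle C₀ (natCombo ψ φ a) := by
  constructor
  · intro hC
    induction hC with
    | left => exact ⟨(1, 0), (0, 1), .one_zero, by rw [natCombo_one_zero]⟩
    | right => exact ⟨(0, 1), (1, 0), Unimodular.one_zero.symm, by rw [natCombo_zero_one]⟩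
    | succ _ _ htangent hS ih ih' =>
      obtain ⟨a, b, hab, rfl⟩ := ih
      obtain ⟨a', b', hab', rfl⟩ := ih'
      have haa' := (h.isExtTangent_natCombo_iff h₀ hab hab').1 htangent
      exact ⟨a + a', a', haa'.add_left,
        by rw [(isSuccessor_iff h₀ (isSpinorPair_natCombo h haa')).1 hS, map_add]⟩
  · have hboth {a b : ℕ × ℕ} (hab : Unimodular a b) :
        Family C₀ (spinorCircle C₀ ψ) (spinorCircle C₀ φ) (spinorCircle C₀ (natCombo ψ φ a)) ∧
        Family C₀ (spinorCircle C₀ ψ) (spinorCircle C₀ φ) (spinorCircle C₀ (natCombo ψ φ b)) := by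
      have hsucc {a b : ℕ × ℕ} (hab : Unimodular a b) :=
        isSuccessor_spinorCircle_add h₀ (isSpinorPair_natCombo h hab)
      induction hab using Unimodular.induction with
      | base => simpa only [natCombo_one_zero, natCombo_zero_one] using ⟨Family.left, Family.right⟩
      | base' => simpa only [natCombo_one_zero, natCombo_zero_one] using ⟨Family.right, Family.left⟩
      | right a b hab ih =>
        rw [map_add]
        exact ⟨ih.1, .succ ih.1 ih.2 ((isSpinorPair_natCombo h hab).isExtTangent h₀) (hsucc hab)⟩
      | left a b hab ih =>
        rw [map_add]
        exact ⟨.succ ih.1 ih.2 ((isSpinorPair_natCombo h hab).isExtTangent h₀) (hsucc hab), ih.2⟩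
    rintro ⟨a, b, hab, rfl⟩
    exact (hboth hab).1

end Family

section FareyCurve

/-- The point `a.2 / (a.1 + a.2)` of the unit interval; the vector `natCombo u w a` is a multiple of
the point of the segment from `u` to `w` with this parameter. -/
noncomputable def fareyPoint (a : ℕ × ℕ) : I :=
  ⟨a.2 / (a.1 + a.2), unitInterval.div_mem (by positivity) (by positivity) (by simp)⟩

theorem coe_fareyPoint (a : ℕ × ℕ) : (fareyPoint a : ℝ) = a.2 / (a.1 + a.2) := rfl

theorem fareyPoint_one_zero : fareyPoint (1, 0) = 0 :=
  Subtype.ext (by simp [coe_fareyPoint])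

theorem fareyPoint_zero_one : fareyPoint (0, 1) = 1 :=
  Subtype.ext (by simp [coe_fareyPoint])

theorem dense_fareyPoint : Dense {s | ∃ a b, Unimodular a b ∧ fareyPoint a = s} := by
  refine dense_of_exists_between fun s t hst ↦ ?_
  obtain ⟨q, hsq, hqt⟩ := exists_rat_btwn (Subtype.coe_lt_coe.2 hst)
  lift q to ℚ≥0 using by exact_mod_cast s.2.1.trans hsq.le
  have hle : q.num ≤ q.den := by
    have : q ≤ 1 := by exact_mod_cast hqt.le.trans t.2.2
    rwa [← NNRat.num_div_den q, div_le_one (by exact_mod_cast q.den_pos), Nat.cast_le] at this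
  obtain ⟨b, hb⟩ := exists_unimodular_of_coprime (p := q.den - q.num) (q := q.num) <| by
    rw [Nat.coprime_sub_self_left hle]
    exact q.coprime_num_den.symm
  have hq : (fareyPoint (q.den - q.num, q.num) : ℝ) = q := by
    rw [coe_fareyPoint, Nat.cast_sub hle, sub_add_cancel]
    exact (NNRat.cast_def q).symm
  refine ⟨_, ⟨_, b, hb, rfl⟩, ?_, ?_⟩ <;>
  · rw [← Subtype.coe_lt_coe, hq]
    assumption_mod_cast

/-- A curve whose chord between Farey neighbours `a` and `b` is parallel to `natCombo u w (a + b)`.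
With `u`, `w` spinors, these are the Apollonian curves in the parameter of `fareyPoint`. -/
structure IsFareyCurve {E : Type*} [TopologicalSpace E] [AddCommGroup E] [Module ℝ E] (u w : E)
    (Γ : I → E) : Prop where
  continuous : Continuous Γ
  chord : ∀ a b, Unimodular a b →
    ∃ t : ℝ, Γ (fareyPoint a) - Γ (fareyPoint b) = t • natCombo u w (a + b)

namespace IsFareyCurve

section Uniqueness

variable {E : Type*} [TopologicalSpace E] [AddCommGroup E] [Module ℝ E] {u w : E} {Γ Γ' : I → E}

theorem sub_smul [IsTopologicalAddGroup E] [ContinuousConstSMul ℝ E] (h' : IsFareyCurve u w Γ')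
    (h : IsFareyCurve u w Γ) (k : ℝ) : IsFareyCurve u w (Γ' - k • Γ) where
  continuous := h'.continuous.sub (h.continuous.const_smul k)
  chord a b hab := by
    obtain ⟨t', ht'⟩ := h'.chord a b hab
    obtain ⟨t, ht⟩ := h.chord a b hab
    refine ⟨t' - k * t, ?_⟩
    simp only [Pi.sub_apply, Pi.smul_apply]
    linear_combination (norm := module) ht' - k • ht

-- The chords from `a` to `a + b` and from `a + b` to `b` are parallel to the independent vectors
-- `2 a + b` and `a + 2 b`, so they vanish if their sum does.
theorem eq_of_unimodular (h : IsFareyCurve u w Γ) (huw : LinearIndependent ℝ ![u, w])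
    {a b : ℕ × ℕ} (hab : Unimodular a b) (heq : Γ (fareyPoint a) = Γ (fareyPoint b)) :
    Γ (fareyPoint (a + b)) = Γ (fareyPoint a) := by
  obtain ⟨s, hs⟩ := h.chord _ _ hab.add_right
  obtain ⟨t, ht⟩ := h.chord _ _ hab.add_left
  have hdet : (a + (a + b)).1 * (a + b + b).2 ≠ (a + (a + b)).2 * (a + b + b).1 := by
    have : (a.1 : ℤ) * b.2 - a.2 * b.1 ≠ 0 := fun h0 ↦ by simp [Unimodular, h0] at hab
    contrapose! this
    zify at this
    push_cast [Prod.fst_add, Prod.snd_add] at this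
    linarith
  have hst : s • natCombo u w (a + (a + b)) = -t • natCombo u w (a + b + b) := by
    rw [neg_smul, ← hs, ← ht, heq, neg_sub]
  rw [eq_zero_of_smul_natCombo_eq huw hdet hst, zero_smul, sub_eq_zero] at hs
  exact hs.symm

theorem eq_of_endpoints_eq [T2Space E] (h : IsFareyCurve u w Γ)
    (huw : LinearIndependent ℝ ![u, w]) (h01 : Γ 0 = Γ 1) (s : I) : Γ s = Γ 0 := by
  have hends {a b : ℕ × ℕ} (hab : Unimodular a b) :
      Γ (fareyPoint a) = Γ 0 ∧ Γ (fareyPoint b) = Γ 0 := by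
    induction hab using Unimodular.induction with
    | base => exact ⟨by rw [fareyPoint_one_zero], by rw [fareyPoint_zero_one, h01]⟩
    | base' => exact ⟨by rw [fareyPoint_zero_one, h01], by rw [fareyPoint_one_zero]⟩
    | right a b hab ih =>
      exact ⟨ih.1, (h.eq_of_unimodular huw hab (ih.1.trans ih.2.symm)).trans ih.1⟩
    | left a b hab ih =>
      exact ⟨(h.eq_of_unimodular huw hab (ih.1.trans ih.2.symm)).trans ih.1, ih.2⟩
  refine congrFun (h.continuous.ext_on dense_fareyPoint continuous_const ?_) s
  rintro _ ⟨a, b, hab, rfl⟩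
  exact (hends hab).1

theorem exists_eq_smul_add [T2Space E] [IsTopologicalAddGroup E] [ContinuousConstSMul ℝ E]
    (h : IsFareyCurve u w Γ) (h' : IsFareyCurve u w Γ') (huw : LinearIndependent ℝ ![u, w])
    (hne : ∃ s t, Γ s ≠ Γ t) : ∃ (k : ℝ) (c : E), ∀ s, Γ' s = k • Γ s + c := by
  obtain ⟨t, ht⟩ := h.chord _ _ .one_zero
  obtain ⟨t', ht'⟩ := h'.chord _ _ .one_zero
  rw [fareyPoint_one_zero, fareyPoint_zero_one] at ht ht'
  have ht0 : t ≠ 0 := by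
    rintro rfl
    obtain ⟨r, s, hrs⟩ := hne
    have hconst := h.eq_of_endpoints_eq huw (sub_eq_zero.1 (ht.trans (zero_smul ..)))
    exact hrs ((hconst r).trans (hconst s).symm)
  have hends : (Γ' - (t' / t) • Γ) 0 = (Γ' - (t' / t) • Γ) 1 := by
    rw [← sub_eq_zero]
    calc (Γ' - (t' / t) • Γ) 0 - (Γ' - (t' / t) • Γ) 1
        = (Γ' 0 - Γ' 1) - (t' / t) • (Γ 0 - Γ 1) := by
          simp only [Pi.sub_apply, Pi.smul_apply]
          module
      _ = 0 := by rw [ht, ht', smul_smul, div_mul_cancel₀ _ ht0, sub_self]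
  exact ⟨t' / t, (Γ' - (t' / t) • Γ) 0, fun s ↦ sub_eq_iff_eq_add'.1 <|
    (h'.sub_smul h (t' / t)).eq_of_endpoints_eq huw hends s⟩

end Uniqueness

theorem map {E F : Type*} [TopologicalSpace E] [AddCommGroup E] [Module ℝ E] [TopologicalSpace F]
    [AddCommGroup F] [Module ℝ F] {u w : E} {Γ : I → E} (h : IsFareyCurve u w Γ) (L : E →L[ℝ] F) :
    IsFareyCurve (L u) (L w) (L ∘ Γ) where
  continuous := L.continuous.comp h.continuous
  chord a b hab := by
    obtain ⟨t, ht⟩ := h.chord a b hab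
    refine ⟨t, ?_⟩
    simp only [Function.comp_apply, ← map_sub, ht, natCombo_apply, map_smul, map_add, map_nsmul]

end IsFareyCurve

open scoped NNReal in
theorem exists_selfSimilar_curve {E : Type*} [NormedAddCommGroup E] [NormedSpace ℝ E]
    [CompleteSpace E] {f g : E → E} {K : ℝ≥0} (hK : K < 1) (hf : LipschitzWith K f)
    (hg : LipschitzWith K g) {x y : E} (hx : f x = x) (hy : g y = y) (hxy : f y = g x)
    {l r : C(I, I)} (hl : l 0 = 0) (hr : r 1 = 1) (hlr : ∀ s, r s = 0 ∨ l s = 1) :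
    ∃ F : C(I, E), F 0 = x ∧ F 1 = y ∧ (∀ s, r s = 0 → F s = f (F (l s))) ∧
      ∀ s, l s = 1 → F s = g (F (r s)) := by
  let S : Set C(I, E) := {F | F 0 = x ∧ F 1 = y}
  let T (F : C(I, E)) : C(I, E) :=
    (⟨f, hf.continuous⟩ : C(E, E)).comp (F.comp l) +
      (⟨g, hg.continuous⟩ : C(E, E)).comp (F.comp r) - .const I (f y)
  have left {F} (hF : F ∈ S) {s} (hs : r s = 0) : T F s = f (F (l s)) := by
    simp [T, hs, hF.1, hxy]
  have right {F} (hF : F ∈ S) {s} (hs : l s = 1) : T F s = g (F (r s)) := by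
    simp [T, hs, hF.2]
  have hmaps : Set.MapsTo T S S := fun F hF ↦
    ⟨by rw [left hF ((hlr 0).resolve_right (by simp [hl])), hl, hF.1, hx],
      by rw [right hF ((hlr 1).resolve_left (by simp [hr])), hr, hF.2, hy]⟩
  have hcontracting : ContractingWith K (hmaps.restrict T S S) := by
    refine ⟨hK, .of_dist_le_mul fun F G ↦ ?_⟩
    refine (ContinuousMap.dist_le (by positivity)).2 fun s ↦ ?_
    rcases hlr s with hs | hs
    · change dist (T F s) (T G s) ≤ _
      rw [left F.2 hs, left G.2 hs]
      exact (hf.dist_le_mul _ _).trans (by gcongr; exact ContinuousMap.dist_apply_le_dist _)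
    · change dist (T F s) (T G s) ≤ _
      rw [right F.2 hs, right G.2 hs]
      exact (hg.dist_le_mul _ _).trans (by gcongr; exact ContinuousMap.dist_apply_le_dist _)
  have hclosed : IsClosed S :=
    (isClosed_eq (by fun_prop) continuous_const).inter (isClosed_eq (by fun_prop) continuous_const)
  let segment : C(I, E) := ⟨fun s ↦ AffineMap.lineMap x y (s : ℝ), by fun_prop⟩
  obtain ⟨F, hF, hfix, -⟩ := hcontracting.exists_fixedPoint' hclosed.isComplete hmaps
    (x := segment) ⟨by simp [segment], by simp [segment]⟩ (edist_ne_top _ _)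
  exact ⟨F, hF.1, hF.2, fun s hs ↦ by rw [← left hF hs, hfix],
    fun s hs ↦ by rw [← right hF hs, hfix]⟩

/-- The map `s ↦ s / (1 - s)` from the left half of the unit interval onto the unit interval,
extended by `1` to the right half. -/
noncomputable def fareyLeft : C(I, I) where
  toFun s := ⟨s / max (s : ℝ) (1 - s), unitInterval.div_mem s.2.1 (le_max_of_le_left s.2.1)
    (le_max_left _ _)⟩
  continuous_toFun := by
    refine Continuous.subtype_mk (Continuous.div (by fun_prop) (by fun_prop) fun s ↦ ?_) _
    exact (lt_max_iff.2 (by by_contra! h; linarith)).ne'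

/-- The mirror image of `fareyLeft`: it maps the right half of the unit interval onto the unit
interval and the left half to `0`. -/
noncomputable def fareyRight : C(I, I) where
  toFun s := σ (fareyLeft (σ s))
  continuous_toFun := by fun_prop

theorem coe_fareyLeft (s : I) : (fareyLeft s : ℝ) = s / max (s : ℝ) (σ s) := rfl

theorem fareyLeft_eq_one {s : I} (h : σ s ≤ s) : fareyLeft s = 1 := by
  have hpos : (s : ℝ) ≠ 0 := fun h0 ↦ by
    have : 1 - (s : ℝ) ≤ s := h
    linarith
  refine Subtype.ext ?_
  rw [coe_fareyLeft, max_eq_left (Subtype.coe_le_coe.2 h), div_self hpos, Set.Icc.coe_one]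

theorem fareyRight_eq_zero {s : I} (h : s ≤ σ s) : fareyRight s = 0 := by
  change σ (fareyLeft (σ s)) = 0
  rw [fareyLeft_eq_one (by rwa [unitInterval.symm_symm]), unitInterval.symm_one]

theorem fareyLeft_zero : fareyLeft 0 = 0 :=
  Subtype.ext (by simp [coe_fareyLeft])

theorem fareyRight_one : fareyRight 1 = 1 := by
  change σ (fareyLeft (σ 1)) = 1
  rw [unitInterval.symm_one, fareyLeft_zero, unitInterval.symm_zero]

theorem fareyRight_eq_zero_or_fareyLeft_eq_one (s : I) : fareyRight s = 0 ∨ fareyLeft s = 1 :=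
  (le_total s (σ s)).imp fareyRight_eq_zero fareyLeft_eq_one

theorem symm_fareyPoint {a : ℕ × ℕ} (ha : a.1 + a.2 ≠ 0) :
    σ (fareyPoint a) = fareyPoint a.swap := by
  have ha' : (a.1 : ℝ) + a.2 ≠ 0 := by exact_mod_cast ha
  refine Subtype.ext ?_
  rw [unitInterval.coe_symm_eq, coe_fareyPoint, coe_fareyPoint, Prod.fst_swap, Prod.snd_swap,
    add_comm (a.2 : ℝ), one_sub_div ha', add_sub_cancel_right]

theorem fareyPoint_le_symm {a : ℕ × ℕ} (ha : a.1 + a.2 ≠ 0) (h : a.2 ≤ a.1) :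
    fareyPoint a ≤ σ (fareyPoint a) := by
  rw [symm_fareyPoint ha, ← Subtype.coe_le_coe, coe_fareyPoint, coe_fareyPoint, Prod.fst_swap,
    Prod.snd_swap, add_comm (a.2 : ℝ)]
  gcongr

theorem symm_le_fareyPoint {a : ℕ × ℕ} (ha : a.1 + a.2 ≠ 0) (h : a.1 ≤ a.2) :
    σ (fareyPoint a) ≤ fareyPoint a := by
  have := fareyPoint_le_symm (a := a.swap) (add_comm a.1 a.2 ▸ ha) h
  rwa [← symm_fareyPoint ha, unitInterval.symm_symm] at this

theorem fareyLeft_fareyPoint {a : ℕ × ℕ} (ha : a.1 + a.2 ≠ 0) :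
    fareyLeft (fareyPoint (a.1 + a.2, a.2)) = fareyPoint a := by
  have hsum : a.1 + a.2 + a.2 ≠ 0 := by omega
  have hle := fareyPoint_le_symm (a := (a.1 + a.2, a.2)) hsum (Nat.le_add_left _ _)
  refine Subtype.ext ?_
  rw [coe_fareyLeft, max_eq_right (Subtype.coe_le_coe.2 hle), symm_fareyPoint hsum, coe_fareyPoint,
    coe_fareyPoint, coe_fareyPoint, Prod.fst_swap, Prod.snd_swap, add_comm (a.2 : ℝ),
    div_div_div_cancel_right₀ (by exact_mod_cast hsum), Nat.cast_add]

theorem fareyRight_fareyPoint {a : ℕ × ℕ} (ha : a.1 + a.2 ≠ 0) :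
    fareyRight (fareyPoint (a.1, a.1 + a.2)) = fareyPoint a := by
  have ha' : a.swap.1 + a.swap.2 ≠ 0 := add_comm a.1 a.2 ▸ ha
  have hleft := fareyLeft_fareyPoint ha'
  change σ (fareyLeft (σ _)) = _
  rw [symm_fareyPoint (by omega), Prod.swap_prod_mk, add_comm a.1]
  exact (congrArg σ hleft).trans (symm_fareyPoint ha')

theorem isFareyCurve_of_selfSimilar {Γ : I → ℝ × ℝ} {k : ℝ} {x : ℝ × ℝ} (hΓ : Continuous Γ)
    (h01 : Γ 1 - Γ 0 = (1, 1))
    (hleft : ∀ a : ℕ × ℕ, a.1 + a.2 ≠ 0 → Γ (fareyPoint (a.1 + a.2, a.2)) =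
      k • ((Γ (fareyPoint a)).1 + (Γ (fareyPoint a)).2, (Γ (fareyPoint a)).2))
    (hright : ∀ a : ℕ × ℕ, a.1 + a.2 ≠ 0 → Γ (fareyPoint (a.1, a.1 + a.2)) =
      x + k • ((Γ (fareyPoint a)).1, (Γ (fareyPoint a)).1 + (Γ (fareyPoint a)).2)) :
    IsFareyCurve (1, 0) (0, 1) Γ := by
  have hcombo (c : ℕ × ℕ) : natCombo (1, 0) (0, 1) c = ((c.1, c.2) : ℝ × ℝ) := by
    simp [natCombo_apply]
  refine ⟨hΓ, fun a b hab ↦ ?_⟩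
  simp only [hcombo, Prod.ext_iff, Prod.fst_sub, Prod.snd_sub, Prod.smul_fst, Prod.smul_snd,
    smul_eq_mul, Prod.fst_add, Prod.snd_add] at h01 hleft hright ⊢
  induction hab using Unimodular.shear_induction with
  | base =>
    rw [fareyPoint_one_zero, fareyPoint_zero_one]
    exact ⟨-1, by push_cast; linarith, by push_cast; linarith⟩
  | base' =>
    rw [fareyPoint_one_zero, fareyPoint_zero_one]
    exact ⟨1, by push_cast; linarith, by push_cast; linarith⟩
  | left a b hab ih =>
    obtain ⟨t, ht₁, ht₂⟩ := ih
    obtain ⟨ha₁, ha₂⟩ := hleft a hab.add_ne_zero_left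
    obtain ⟨hb₁, hb₂⟩ := hleft b hab.symm.add_ne_zero_left
    rw [ha₁, ha₂, hb₁, hb₂]
    push_cast at ht₁ ht₂ ⊢
    exact ⟨k * t, by linear_combination k * ht₁ + k * ht₂, by linear_combination k * ht₂⟩
  | right a b hab ih =>
    obtain ⟨t, ht₁, ht₂⟩ := ih
    obtain ⟨ha₁, ha₂⟩ := hright a hab.add_ne_zero_left
    obtain ⟨hb₁, hb₂⟩ := hright b hab.symm.add_ne_zero_left
    rw [ha₁, ha₂, hb₁, hb₂]
    push_cast at ht₁ ht₂ ⊢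
    exact ⟨k * t, by linear_combination k * ht₁, by linear_combination k * ht₁ + k * ht₂⟩

theorem exists_isFareyCurve_one_zero :
    ∃ Γ : I → ℝ × ℝ, IsFareyCurve (1, 0) (0, 1) Γ ∧ Γ 0 ≠ Γ 1 := by
  -- In coefficients with respect to `u`, `w`, passing to the left or right half of a Farey
  -- interval is a shear; scaling it by `1 / 3` makes the two images of the chord `(1, 1)`,
  -- namely `(2, 1) / 3` and `(1, 2) / 3`, add up to it.
  let f (z : ℝ × ℝ) : ℝ × ℝ := (1 / 3 : ℝ) • (z.1 + z.2, z.2)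
  let g (z : ℝ × ℝ) : ℝ × ℝ := (2 / 3, 1 / 3) + (1 / 3 : ℝ) • (z.1, z.1 + z.2)
  have hsum : LipschitzWith (1 + 1) fun z : ℝ × ℝ ↦ z.1 + z.2 := .add .prod_fst .prod_snd
  have hf : LipschitzWith (2 / 3) f :=
    ((lipschitzWith_smul (1 / 3 : ℝ)).comp (hsum.prodMk .prod_snd)).weaken (by norm_num)
  have hg : LipschitzWith (2 / 3) g :=
    ((LipschitzWith.const _).add
      ((lipschitzWith_smul (1 / 3 : ℝ)).comp (LipschitzWith.prod_fst.prodMk hsum))).weaken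
      (by norm_num)
  obtain ⟨F, hF0, hF1, hleft, hright⟩ := exists_selfSimilar_curve (by norm_num) hf hg
    (x := 0) (y := (1, 1)) (l := fareyLeft) (r := fareyRight)
    (by simp [f]) (by norm_num [g]) (by norm_num [f, g])
    fareyLeft_zero fareyRight_one fareyRight_eq_zero_or_fareyLeft_eq_one
  refine ⟨F, isFareyCurve_of_selfSimilar (k := 1 / 3) (x := (2 / 3, 1 / 3)) F.continuous
    (by rw [hF0, hF1, sub_zero]) (fun a ha ↦ ?_) (fun a ha ↦ ?_), by simp [hF0, hF1, Prod.ext_iff]⟩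
  · rw [hleft _ (fareyRight_eq_zero (fareyPoint_le_symm (by omega) (by simp))),
      fareyLeft_fareyPoint ha]
  · rw [hright _ (fareyLeft_eq_one (symm_le_fareyPoint (by omega) (by simp))),
      fareyRight_fareyPoint ha]

theorem exists_isFareyCurve {E : Type*} [TopologicalSpace E] [AddCommGroup E] [Module ℝ E]
    [IsTopologicalAddGroup E] [ContinuousSMul ℝ E] {u w : E} (huw : LinearIndependent ℝ ![u, w]) :
    ∃ Γ : I → E, IsFareyCurve u w Γ ∧ ∃ s t, Γ s ≠ Γ t := by
  obtain ⟨Γ, hΓ, hne⟩ := exists_isFareyCurve_one_zero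
  let L : ℝ × ℝ →L[ℝ] E :=
    (ContinuousLinearMap.toSpanSingleton ℝ u).coprod (ContinuousLinearMap.toSpanSingleton ℝ w)
  have hL : Function.Injective L := by
    refine (injective_iff_map_eq_zero L).2 fun z hz ↦ ?_
    exact Prod.ext_iff.2 (LinearIndependent.pair_iff.1 huw z.1 z.2 (by simpa [L] using hz))
  have hmap := hΓ.map L
  simp only [L, ContinuousLinearMap.coprod_apply, ContinuousLinearMap.toSpanSingleton_apply,
    one_smul, zero_smul, add_zero, zero_add] at hmap
  exact ⟨L ∘ Γ, hmap, 0, 1, hL.ne hne⟩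

end FareyCurve

section Angle

variable {C₀ : PlaneCircle} {ψ φ χ : ℂ}

theorem range_eq_uIcc_of_continuous_of_injective {θ : I → ℝ} (hθ : Continuous θ)
    (hinj : Function.Injective θ) : Set.range θ = Set.uIcc (θ 0) (θ 1) := by
  refine (Set.range_subset_iff.2 fun s ↦ Set.mem_uIcc.2 ?_).antisymm ?_
  · exact (hθ.strictMono_of_inj_boundedOrder' hinj).imp
      (fun h ↦ ⟨h.monotone bot_le, h.monotone le_top⟩)
      (fun h ↦ ⟨h.antitone le_top, h.antitone bot_le⟩)
  · rw [Set.uIcc_eq_union]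
    exact Set.union_subset (intermediate_value_univ _ _ hθ) (intermediate_value_univ _ _ hθ)

theorem arg_sq_of_re_pos {z : ℂ} (hz : 0 < z.re) : (z ^ 2).arg = 2 * z.arg := by
  have hz0 : z ≠ 0 := by
    rintro rfl
    exact hz.ne rfl
  have harg := abs_lt.1 (Complex.abs_arg_lt_pi_div_two_iff.2 (.inl hz))
  rw [pow_two, two_mul]
  exact Complex.arg_mul hz0 hz0 ⟨by linarith, by linarith⟩

theorem div_re_pos_iff (hψ : ψ ≠ 0) : 0 < (χ / ψ).re ↔ 0 < ⟪ψ, χ⟫_ℝ := by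
  have hdiv : (χ / ψ).re = ⟪ψ, χ⟫_ℝ / Complex.normSq ψ := by
    rw [Complex.div_re, Complex.inner, Complex.mul_re, Complex.conj_re, Complex.conj_im]
    ring
  rw [hdiv, div_pos_iff_of_pos_right (Complex.normSq_pos.2 hψ)]

theorem angle_spinorCircle (h₀ : 0 < C₀.radius) (hψ : 1 < ‖ψ‖) (hχ : 1 < ‖χ‖)
    (hpos : 0 < ⟪ψ, χ⟫_ℝ) :
    angle C₀ (spinorCircle C₀ ψ) (spinorCircle C₀ χ) =
      (v C₀ (spinorCircle C₀ ψ)).arg + 2 * (χ / ψ).arg := by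
  have hψ0 : ψ ≠ 0 := norm_pos_iff.1 (one_pos.trans hψ)
  have hquot : v C₀ (spinorCircle C₀ χ) / v C₀ (spinorCircle C₀ ψ) =
      ((spinorCircle C₀ χ).radius / (spinorCircle C₀ ψ).radius : ℝ) * (χ / ψ) ^ 2 := by
    rw [v_spinorCircle, v_spinorCircle, Complex.real_smul, Complex.real_smul]
    push_cast
    ring
  rw [angle, hquot, Complex.arg_real_mul _ (div_pos (spinorCircle_radius_pos h₀ hχ)
    (spinorCircle_radius_pos h₀ hψ)), arg_sq_of_re_pos ((div_re_pos_iff hψ0).2 hpos)]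

/-- The angle at which a point of the segment from `ψ` to `φ` sees the circles whose spinors are
multiples of it, when angles are normalized by the circle with spinor `ψ`. -/
noncomputable def spinorAngle (C₀ : PlaneCircle) (ψ φ : ℂ) (s : I) : ℝ :=
  (v C₀ (spinorCircle C₀ ψ)).arg + 2 * (AffineMap.lineMap ψ φ (s : ℝ) / ψ).arg

namespace IsSpinorPair

theorem ne_zero_left (h : IsSpinorPair ψ φ) : ψ ≠ 0 :=
  norm_pos_iff.1 (one_pos.trans h.one_lt_norm_left)

theorem areaForm_ne_zero (h : IsSpinorPair ψ φ) : ω ψ φ ≠ 0 := fun h0 ↦ by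
  simpa [h0] using h.areaForm_sq

theorem linearIndependent (h : IsSpinorPair ψ φ) : LinearIndependent ℝ ![ψ, φ] := by
  refine LinearIndependent.pair_iff.2 fun s t hst ↦ ⟨?_, ?_⟩
  · have := congrArg (ω · φ) hst
    simpa only [map_add, map_smul, LinearMap.add_apply, LinearMap.smul_apply, map_zero,
      LinearMap.zero_apply, smul_eq_mul, Complex.orientation.areaForm_apply_self, mul_zero,
      add_zero, mul_eq_zero, h.areaForm_ne_zero, or_false] using this
  · have := congrArg (ω ψ) hst
    simpa only [map_add, map_smul, map_zero, smul_eq_mul,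
      Complex.orientation.areaForm_apply_self, mul_zero, zero_add, mul_eq_zero,
      h.areaForm_ne_zero, or_false] using this

theorem inner_lineMap_pos (h : IsSpinorPair ψ φ) (s : I) :
    0 < ⟪ψ, AffineMap.lineMap ψ φ (s : ℝ)⟫_ℝ := by
  rw [AffineMap.lineMap_apply_module, inner_add_right, real_inner_smul_right,
    real_inner_smul_right]
  exact convex_Ioi (0 : ℝ) (real_inner_self_pos.2 h.ne_zero_left) h.inner_pos
    (sub_nonneg.2 s.2.2) s.2.1 (sub_add_cancel ..)

theorem continuous_spinorAngle (h : IsSpinorPair ψ φ) : Continuous (spinorAngle C₀ ψ φ) := by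
  refine continuous_const.add (continuous_const.mul (continuous_iff_continuousAt.2 fun s ↦ ?_))
  refine ContinuousAt.comp (f := fun s : I ↦ AffineMap.lineMap ψ φ (s : ℝ) / ψ)
    (Complex.continuousAt_arg (.inl ?_)) (by fun_prop)
  exact (div_re_pos_iff h.ne_zero_left).2 (h.inner_lineMap_pos s)

theorem injective_spinorAngle (h : IsSpinorPair ψ φ) :
    Function.Injective (spinorAngle C₀ ψ φ) := by
  intro s t hst
  have hray : SameRay ℝ (AffineMap.lineMap ψ φ (s : ℝ) / ψ) (AffineMap.lineMap ψ φ (t : ℝ) / ψ) :=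
    Complex.sameRay_iff.2 (.inr (.inr (by simpa [spinorAngle] using hst)))
  have harea := ((Complex.orientation.nonneg_inner_and_areaForm_eq_zero_iff_sameRay _ _).2 hray).2
  have hline : ω (AffineMap.lineMap ψ φ (s : ℝ)) (AffineMap.lineMap ψ φ (t : ℝ)) =
      (t - s) * ω ψ φ := by
    simp only [AffineMap.lineMap_apply_module, map_add, map_smul, LinearMap.add_apply,
      LinearMap.smul_apply, smul_eq_mul, Complex.orientation.areaForm_apply_self,
      Complex.orientation.areaForm_swap φ ψ]
    ring
  have hzero : ((t : ℝ) - s) * ω ψ φ = 0 := by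
    rw [← hline, ← mul_div_cancel₀ (AffineMap.lineMap ψ φ (s : ℝ)) h.ne_zero_left,
      ← mul_div_cancel₀ (AffineMap.lineMap ψ φ (t : ℝ)) h.ne_zero_left, areaForm_mul_mul, harea,
      mul_zero]
  exact Subtype.ext (sub_eq_zero.1 ((mul_eq_zero.1 hzero).resolve_right h.areaForm_ne_zero)).symm

theorem isInducing_spinorAngle (h : IsSpinorPair ψ φ) :
    Topology.IsInducing (spinorAngle C₀ ψ φ) :=
  (h.continuous_spinorAngle.isClosedEmbedding h.injective_spinorAngle).isInducing

theorem angle_natCombo (h₀ : 0 < C₀.radius) (h : IsSpinorPair ψ φ) {a b : ℕ × ℕ}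
    (hab : Unimodular a b) :
    angle C₀ (spinorCircle C₀ ψ) (spinorCircle C₀ (natCombo ψ φ a)) =
      spinorAngle C₀ ψ φ (fareyPoint a) := by
  have hsum : (0 : ℝ) < (a.1 + a.2 : ℕ) := by
    exact_mod_cast Nat.pos_of_ne_zero hab.add_ne_zero_left
  have hcombo : natCombo ψ φ a =
      ((a.1 + a.2 : ℕ) : ℝ) • AffineMap.lineMap ψ φ (fareyPoint a : ℝ) := by
    have hfst : ((a.1 + a.2 : ℕ) : ℝ) * (1 - fareyPoint a) = a.1 := by
      rw [coe_fareyPoint]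
      push_cast at hsum ⊢
      field_simp
      ring
    have hsnd : ((a.1 + a.2 : ℕ) : ℝ) * fareyPoint a = a.2 := by
      rw [coe_fareyPoint]
      push_cast at hsum ⊢
      field_simp
    rw [AffineMap.lineMap_apply_module, smul_add, smul_smul, smul_smul, hfst, hsnd,
      natCombo_apply, Nat.cast_smul_eq_nsmul, Nat.cast_smul_eq_nsmul]
  have hpos : 0 < ⟪ψ, natCombo ψ φ a⟫_ℝ := by
    rw [hcombo, real_inner_smul_right]
    exact mul_pos hsum (h.inner_lineMap_pos _)
  rw [angle_spinorCircle h₀ h.one_lt_norm_left (isSpinorPair_natCombo h hab).one_lt_norm_left hpos,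
    spinorAngle, hcombo, Complex.real_smul, mul_div_assoc, Complex.arg_real_mul _ hsum]

theorem range_spinorAngle (h₀ : 0 < C₀.radius) (h : IsSpinorPair ψ φ) :
    Set.range (spinorAngle C₀ ψ φ) =
      angleInterval C₀ (spinorCircle C₀ ψ) (spinorCircle C₀ φ) := by
  have hleft := h.angle_natCombo h₀ .one_zero
  have hright := h.angle_natCombo h₀ Unimodular.one_zero.symm
  rw [natCombo_one_zero, fareyPoint_one_zero] at hleft
  rw [natCombo_zero_one, fareyPoint_zero_one] at hright
  rw [range_eq_uIcc_of_continuous_of_injective h.continuous_spinorAngle h.injective_spinorAngle,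
    angleInterval, hleft, hright]

end IsSpinorPair

theorem isApollonianCurve_iff {γ : ℝ → ℂ} (h₀ : 0 < C₀.radius) (h : IsSpinorPair ψ φ) :
    IsApollonianCurve C₀ (spinorCircle C₀ ψ) (spinorCircle C₀ φ) γ ↔
      IsFareyCurve ψ φ (γ ∘ spinorAngle C₀ ψ φ) := by
  have hrange := h.range_spinorAngle h₀
  have hcont : ContinuousOn γ (angleInterval C₀ (spinorCircle C₀ ψ) (spinorCircle C₀ φ)) ↔
      Continuous (γ ∘ spinorAngle C₀ ψ φ) := by
    rw [← hrange, ← Set.image_univ, h.isInducing_spinorAngle.continuousOn_image_iff,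
      continuousOn_univ]
  have hchord {a b : ℕ × ℕ} (hab : Unimodular a b) (z : ℂ) :
      (∃ S, IsSuccessor C₀ (spinorCircle C₀ (natCombo ψ φ a))
        (spinorCircle C₀ (natCombo ψ φ b)) S ∧ z ∈ sqrtLine C₀ S) ↔
          ∃ t : ℝ, z = t • natCombo ψ φ (a + b) := by
    simp only [isSuccessor_iff h₀ (isSpinorPair_natCombo h hab), exists_eq_left, ← map_add]
    exact mem_sqrtLine_spinorCircle h₀ (isSpinorPair_natCombo h hab.add_left).one_lt_norm_left
  constructor
  · rintro ⟨hγ, hγchord⟩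
    refine ⟨hcont.1 hγ, fun a b hab ↦ ?_⟩
    obtain ⟨-, -, hS⟩ := hγchord _ _ ((family_spinorCircle_iff h₀ h).2 ⟨a, b, hab, rfl⟩)
      ((family_spinorCircle_iff h₀ h).2 ⟨b, a, hab.symm, rfl⟩)
      ((isSpinorPair_natCombo h hab).isExtTangent h₀)
    rwa [hchord hab, h.angle_natCombo h₀ hab, h.angle_natCombo h₀ hab.symm] at hS
  · rintro ⟨hΓ, hΓchord⟩
    refine ⟨hcont.2 hΓ, fun C C' hC hC' htangent ↦ ?_⟩
    obtain ⟨a, a', ha, rfl⟩ := (family_spinorCircle_iff h₀ h).1 hC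
    obtain ⟨b, b', hb, rfl⟩ := (family_spinorCircle_iff h₀ h).1 hC'
    have hab := (h.isExtTangent_natCombo_iff h₀ ha hb).1 htangent
    rw [hchord hab, h.angle_natCombo h₀ hab, h.angle_natCombo h₀ hab.symm, ← hrange]
    exact ⟨Set.mem_range_self _, Set.mem_range_self _, hΓchord a b hab⟩

theorem nonconstant_iff {γ : ℝ → ℂ} (h₀ : 0 < C₀.radius) (h : IsSpinorPair ψ φ) :
    Nonconstant C₀ (spinorCircle C₀ ψ) (spinorCircle C₀ φ) γ ↔
      ∃ s t, (γ ∘ spinorAngle C₀ ψ φ) s ≠ (γ ∘ spinorAngle C₀ ψ φ) t := by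
  simp only [Nonconstant, ← h.range_spinorAngle h₀, Set.exists_range_iff, Function.comp_apply]

end Angle

end Apollonian

theorem theorem5p2 (C₀ C₁ C₂ : Apollonian.PlaneCircle)
    (hr₀ : 0 < C₀.radius) (hr₁ : 0 < C₁.radius) (hr₂ : 0 < C₂.radius)
    (h₀₁ : C₀.IsExtTangent C₁) (h₀₂ : C₀.IsExtTangent C₂) (h₁₂ : C₁.IsExtTangent C₂) :
    (∃ γ : ℝ → ℂ, Apollonian.IsApollonianCurve C₀ C₁ C₂ γ ∧
      Apollonian.Nonconstant C₀ C₁ C₂ γ) ∧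
    (∀ γ γ' : ℝ → ℂ, Apollonian.IsApollonianCurve C₀ C₁ C₂ γ →
      Apollonian.Nonconstant C₀ C₁ C₂ γ → Apollonian.IsApollonianCurve C₀ C₁ C₂ γ' →
      ∃ (a : ℝ) (b : ℂ), ∀ t ∈ Apollonian.angleInterval C₀ C₁ C₂, γ' t = a * γ t + b) := by
  obtain ⟨ψ, φ, h, rfl, rfl⟩ := Apollonian.exists_isSpinorPair hr₀ hr₁ hr₂ h₀₁ h₀₂ h₁₂
  simp only [Apollonian.isApollonianCurve_iff hr₀ h, Apollonian.nonconstant_iff hr₀ h]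
  constructor
  · obtain ⟨Γ, hΓ, hne⟩ := Apollonian.exists_isFareyCurve h.linearIndependent
    refine ⟨Function.extend (Apollonian.spinorAngle C₀ ψ φ) Γ 0, ?_⟩
    rw [Function.extend_comp h.injective_spinorAngle]
    exact ⟨hΓ, hne⟩
  · intro γ γ' hγ hne hγ'
    obtain ⟨a, b, hab⟩ := hγ.exists_eq_smul_add hγ' h.linearIndependent hne
    rw [← h.range_spinorAngle hr₀]
    exact ⟨a, b, Set.forall_mem_range.2 hab⟩
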